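/- Let $\{X_n\}_{n\ge 1}$ be real random variables on a probability space with mixing coefficients $$\varphi(m)=\sup\{|P(B\mid A)-P(B)| : k\ge 1,\ A\in\sigma(X_1,\dots,X_k),\ P(A)>0,\ B\in\sigma(X_{k+m},X_{k+m+1},\dots)\},\qquad m\ge 1,$$ and suppose that $\varphi(m)\le C(m+1)^{-r}$ for all $m\ge 1$, with constants $C>0$ and $r>2$. Put $\varphi=\sum_{m\ge 1}\varphi(m)^{1/2}$. Let $0<\alpha<1$ and suppose that $0<\nu_\alpha:=\sup_{n\ge1}E|X_n|^{1+\alpha}<\infty$ and that $E X_k=\mu$ for all $k\ge 1$. Let $0\le\alpha'<\alpha$ and $\delta\in(0,1)$, and set $$\beta=\frac{\alpha r+1}{(1+\alpha)(1+r)},\quad \gamma=\frac{\alpha r+\alpha'}{(1+\alpha)(1+r)},\quad A=e^{1/4+\sqrt e\,C4^r},\quad p=2\log(1/\delta),$$ $$a_1=\sqrt{3c\,\nu_\alpha(1+4\varphi)},\quad a_2=2(c_\alpha\nu_\alpha)^{1/(1+\alpha)},\quad c_\alpha=\min_{\varepsilon>0}\Big(2+\varepsilon+\frac{1+4\varphi}{[1-(1+\varepsilon)^{-1}]^2}\cdot\frac{4}{(1-\alpha)^2}\Big).$$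 Let $c_0$ be defined by $2A\delta^{c_0}=\delta/2$ and $n_1>0$ by $p^{-\alpha}(p/n_1)^{(\alpha-\alpha')/(1+r)}=\delta/2$, and let $c\ge c_0$. Then there is a positive number $n_0$, depending only on $\delta,\alpha,r,C,\nu_\alpha,\varphi,c$, such that for every integer $n\ge\max\{n_0,n_1\}$, with probability at least $1-\delta$, $$\Big|\frac1n\sum_{k=1}^nX_k-\mu\Big|<a_1\Big(\frac{2\log(1/\delta)}{n}\Big)^{\beta}+a_2\Big(\frac{2\log(1/\delta)}{n}\Big)^{\gamma}.$$ -/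

import Mathlib

open MeasureTheory ProbabilityTheory
open scoped ENNReal

noncomputable section

/-- The σ-algebra generated by the random variables `X i`, `i ∈ s`. -/
abbrev sigmaOf {Ω : Type*} (X : ℕ → Ω → ℝ) (s : Set ℕ) : MeasurableSpace Ω :=
  ⨆ i ∈ s, MeasurableSpace.comap (X i) (inferInstance : MeasurableSpace ℝ)

/-- The `φ`-mixing coefficient `φ(m)` of the sequence `X 1, X 2, …`: the supremum of
`|P(B | A) - P(B)|` over `k ≥ 1`, `A ∈ σ(X 1, …, X k)` with `P(A) > 0` and
`B ∈ σ(X (k+m), X (k+m+1), …)`. -/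
def phiMixing {Ω : Type*} [MeasurableSpace Ω] (P : Measure Ω) (X : ℕ → Ω → ℝ) (m : ℕ) : ℝ :=
  sSup {d : ℝ | ∃ k : ℕ, 1 ≤ k ∧ ∃ A B : Set Ω,
    MeasurableSet[sigmaOf X (Set.Icc 1 k)] A ∧ 0 < P A ∧
    MeasurableSet[sigmaOf X (Set.Ici (k + m))] B ∧
    d = |(cond P A).real B - P.real B|}

/-- `∑_{m ≥ 1} φ(m)^{1/2}`. -/
def phiMixingSum {Ω : Type*} [MeasurableSpace Ω] (P : Measure Ω) (X : ℕ → Ω → ℝ) : ℝ :=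
  ∑' m : ℕ, Real.sqrt (phiMixing P X (m + 1))

/-- `ν_α = sup_{n ≥ 1} E |X n|^{1+α}`, as an extended nonnegative real. -/
def momentSup {Ω : Type*} [MeasurableSpace Ω] (P : Measure Ω) (X : ℕ → Ω → ℝ) (α : ℝ) : ℝ≥0∞ :=
  ⨆ n ∈ Set.Ici (1 : ℕ), ∫⁻ ω, ENNReal.ofReal (|X n ω| ^ (1 + α)) ∂P

/-- `f(ε) = 2 + ε + (1 + 4φ) / (1 - 1/(1+ε))² · 4/(1-α)²`. -/
def momentFactor (α φ ε : ℝ) : ℝ :=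
  2 + ε + (1 + 4 * φ) / (1 - (1 + ε)⁻¹) ^ 2 * (4 / (1 - α) ^ 2)

/-- The constant `c_α = min_{ε > 0} f(ε)`. -/
def momentConst (α φ : ℝ) : ℝ :=
  sInf (momentFactor α φ '' Set.Ioi 0)

/-- `a₁ = √(3 c ν (1 + 4φ))`. -/
def coeffMain (c ν φ : ℝ) : ℝ :=
  Real.sqrt (3 * c * ν * (1 + 4 * φ))

/-- `a₂ = 2 (c_α ν)^{1/(1+α)}`. -/
def coeffTail (α ν φ : ℝ) : ℝ :=
  2 * (momentConst α φ * ν) ^ (1 / (1 + α))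

/-- `β = (α r + 1) / ((1 + α)(1 + r))`. -/
def rateMain (α r : ℝ) : ℝ :=
  (α * r + 1) / ((1 + α) * (1 + r))

/-- `γ = (α r + α') / ((1 + α)(1 + r))`. -/
def rateTail (α α' r : ℝ) : ℝ :=
  (α * r + α') / ((1 + α) * (1 + r))

/-- `A = exp (1/4 + √e C 4^r)`. -/
def prefactor (C r : ℝ) : ℝ :=
  Real.exp (1 / 4 + Real.sqrt (Real.exp 1) * C * (4 : ℝ) ^ r)

end

/-! The second term `a` of the bound suffices by itself; the first is used only through its
nonnegativity. No exponential inequality is needed: a weak-type moment bound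
(`measureReal_sum_sub_ge_le`) does the work.

Truncate each variable at the level `t = n * a` and suppose `q * (n * ν) ≤ t ^ (1 + α)`. If the sum
deviates from `n * μ` by at least `t`, then either some `|X k|` exceeds `t`, which by Markov has
probability at most `1 / q`, or the truncated sum deviates from its own mean by at least `t * (1 - 1
/ q)`, because truncation shifts the mean by at most `t / q`. The latter event is handled by
Chebyshev. The variance of the truncated sum is at most `(1 + 4φ) t² / q`, by Ibragimov's covariance
inequality (`sq_cov_le_of_bounded`) summed over lags (`variance_sum_comp_le`).

The equation defining `n₁` makes `q = 2 ^ (2 + α) * c_α / δ` admissible (`mul_le_tail_rpow`), and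
the lower bound for `c_α` in `le_momentConst` then brings the total probability below `δ`. -/

open Filter Topology

/-! ### Ibragimov's covariance inequality. -/

section Covariance

variable {Ω : Type*}

theorem measureReal_inter_preimage_finset {mΩ : MeasurableSpace Ω} {ι : Type*} (P : Measure Ω)
    [IsFiniteMeasure P] (A : Set Ω) (W : Ω → ι) (s : Finset ι)
    (hW : ∀ x, MeasurableSet (W ⁻¹' {x})) :
    P.real (A ∩ W ⁻¹' (s : Set ι)) = ∑ x ∈ s, P.real (A ∩ W ⁻¹' {x}) := by
  have h : ∀ x, P.real (A ∩ W ⁻¹' {x}) = (P.restrict A).real (W ⁻¹' {x}) := fun x => by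
    rw [measureReal_restrict_apply (hW x), Set.inter_comm]
  have hs : W ⁻¹' (s : Set ι) = ⋃ x ∈ s, W ⁻¹' {x} := by ext; simp
  have hm : MeasurableSet (W ⁻¹' (s : Set ι)) := by
    rw [hs]; exact Finset.measurableSet_biUnion _ fun x _ => hW x
  rw [Set.inter_comm, ← measureReal_restrict_apply hm, hs, measureReal_biUnion_finset _ fun x _ => hW x]
  · exact (Finset.sum_congr rfl fun x _ => h x).symm
  · intro x _ y _ hxy
    exact Disjoint.preimage _ (by simpa using hxy)

theorem integral_comp_of_finite_range {mΩ : MeasurableSpace Ω} {ι : Type*} (P : Measure Ω)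
    [IsFiniteMeasure P] (W : Ω → ι) (s : Finset ι) (hs : ∀ ω, W ω ∈ s)
    (hW : ∀ x, MeasurableSet (W ⁻¹' {x})) (f : ι → ℝ) :
    ∫ ω, f (W ω) ∂P = ∑ x ∈ s, f x * P.real (W ⁻¹' {x}) := by
  classical
  have h : ∀ ω, f (W ω) = ∑ x ∈ s, (W ⁻¹' {x}).indicator (fun _ => f x) ω := fun ω => by
    rw [Finset.sum_eq_single (W ω)]
    · simp
    · intro b _ hb
      rw [Set.indicator_of_notMem]
      simpa using hb.symm
    · intro h; exact absurd (hs ω) h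
  simp_rw [h]
  rw [integral_finsetSum]
  · refine Finset.sum_congr rfl fun x _ => ?_
    rw [integral_indicator_const _ (hW x), smul_eq_mul, mul_comm]
  · intro x _
    exact (integrable_const _).indicator (hW x)

/-- Cauchy–Schwarz with respect to the signed weights `D`. -/
theorem sq_sum_mul_le {ι : Type*} (s : Finset ι) (x y D : ι → ℝ) :
    (∑ i ∈ s, x i * y i * D i) ^ 2 ≤ (∑ i ∈ s, x i ^ 2 * |D i|) * ∑ i ∈ s, y i ^ 2 * |D i| := by
  calc (∑ i ∈ s, x i * y i * D i) ^ 2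
      ≤ (∑ i ∈ s, |x i| * |y i| * |D i|) ^ 2 := by
        rw [← sq_abs]
        gcongr
        refine (Finset.abs_sum_le_sum_abs _ _).trans (le_of_eq ?_)
        simp [abs_mul]
    _ = (∑ i ∈ s, (|x i| * √|D i|) * (|y i| * √|D i|)) ^ 2 := by
        congr 1
        refine Finset.sum_congr rfl fun i _ => ?_
        have := Real.mul_self_sqrt (abs_nonneg (D i))
        linear_combination -(|x i| * |y i|) * this
    _ ≤ (∑ i ∈ s, (|x i| * √|D i|) ^ 2) * ∑ i ∈ s, (|y i| * √|D i|) ^ 2 :=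
        Finset.sum_mul_sq_le_sq_mul_sq _ _ _
    _ = _ := by
        simp_rw [mul_pow, Real.sq_sqrt (abs_nonneg _), sq_abs]

/-- Ibragimov's covariance inequality for finitely valued functions. -/
theorem sq_cov_le_of_finite_range {m₁ m₂ mΩ : MeasurableSpace Ω} (h₁ : m₁ ≤ mΩ) (h₂ : m₂ ≤ mΩ)
    (P : Measure Ω) [IsProbabilityMeasure P] {ρ : ℝ}
    (hρ : ∀ A B, MeasurableSet[m₁] A → MeasurableSet[m₂] B →
      |P.real (A ∩ B) - P.real A * P.real B| ≤ ρ * P.real A)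
    (U V : Ω → ℝ) (hU : Measurable[m₁] U) (hV : Measurable[m₂] V) (s t : Finset ℝ)
    (hs : ∀ ω, U ω ∈ s) (ht : ∀ ω, V ω ∈ t) :
    (∫ ω, U ω * V ω ∂P - (∫ ω, U ω ∂P) * ∫ ω, V ω ∂P) ^ 2 ≤
      4 * ρ * (∫ ω, U ω ^ 2 ∂P) * ∫ ω, V ω ^ 2 ∂P := by
  classical
  have hUa : ∀ a, MeasurableSet[m₁] (U ⁻¹' {a}) := fun a => hU (measurableSet_singleton a)
  have hVb : ∀ b, MeasurableSet[m₂] (V ⁻¹' {b}) := fun b => hV (measurableSet_singleton b)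
  have hUa' : ∀ a, MeasurableSet (U ⁻¹' {a}) := fun a => h₁ _ (hUa a)
  have hVb' : ∀ b, MeasurableSet (V ⁻¹' {b}) := fun b => h₂ _ (hVb b)
  set p : ℝ → ℝ := fun a => P.real (U ⁻¹' {a}) with hp
  set q : ℝ → ℝ := fun b => P.real (V ⁻¹' {b}) with hq
  set D : ℝ → ℝ → ℝ := fun a b => P.real (U ⁻¹' {a} ∩ V ⁻¹' {b}) - p a * q b with hD
  have iU : ∀ f : ℝ → ℝ, ∫ ω, f (U ω) ∂P = ∑ a ∈ s, f a * p a :=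
    integral_comp_of_finite_range P U s hs hUa'
  have iV : ∀ f : ℝ → ℝ, ∫ ω, f (V ω) ∂P = ∑ b ∈ t, f b * q b :=
    integral_comp_of_finite_range P V t ht hVb'
  have iUV : ∫ ω, U ω * V ω ∂P =
      ∑ x ∈ s ×ˢ t, x.1 * x.2 * P.real (U ⁻¹' {x.1} ∩ V ⁻¹' {x.2}) := by
    have hpre : ∀ x : ℝ × ℝ, (fun ω => (U ω, V ω)) ⁻¹' {x} = U ⁻¹' {x.1} ∩ V ⁻¹' {x.2} := by
      intro x; ext ω; simp [Prod.ext_iff]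
    have := integral_comp_of_finite_range P (fun ω => (U ω, V ω)) (s ×ˢ t)
      (fun ω => by simp [hs, ht]) (fun x => by rw [hpre]; exact (hUa' _).inter (hVb' _))
      (fun x => x.1 * x.2)
    simpa only [hpre] using this
  have hcov : ∫ ω, U ω * V ω ∂P - (∫ ω, U ω ∂P) * ∫ ω, V ω ∂P =
      ∑ x ∈ s ×ˢ t, x.1 * x.2 * D x.1 x.2 := by
    have e1 := iU (fun x => x)
    have e2 := iV (fun x => x)
    rw [iUV, e1, e2, Finset.sum_mul_sum, ← Finset.sum_product', ← Finset.sum_sub_distrib]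
    refine Finset.sum_congr rfl fun x _ => ?_
    simp only [hD]; ring
  -- Split the values `b` by the sign of `D a b`. On each half the sum is the mixing difference for
  -- one event, a union of fibres of `V`, so each half costs `ρ * p a`.
  have hcol : ∀ a, ∑ b ∈ t, |D a b| ≤ 2 * ρ * p a := by
    intro a
    have key : ∀ t' : Finset ℝ, |∑ b ∈ t', D a b| ≤ ρ * p a := by
      intro t'
      have := hρ (U ⁻¹' {a}) (V ⁻¹' (t' : Set ℝ)) (hUa a) (hV t'.measurableSet)
      rw [measureReal_inter_preimage_finset P _ V t' hVb'] at this
      have h2 := measureReal_inter_preimage_finset P Set.univ V t' hVb'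
      simp only [Set.univ_inter] at h2
      rw [h2, Finset.mul_sum, ← Finset.sum_sub_distrib] at this
      exact this
    rw [← Finset.sum_filter_add_sum_filter_not t (fun b => 0 ≤ D a b)]
    have e1 : ∑ b ∈ t with 0 ≤ D a b, |D a b| = ∑ b ∈ t with 0 ≤ D a b, D a b :=
      Finset.sum_congr rfl fun b hb => abs_of_nonneg (Finset.mem_filter.1 hb).2
    have e2 : ∑ b ∈ t with ¬ 0 ≤ D a b, |D a b| = -∑ b ∈ t with ¬ 0 ≤ D a b, D a b := by
      rw [← Finset.sum_neg_distrib]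
      exact Finset.sum_congr rfl fun b hb =>
        abs_of_neg (not_le.1 (Finset.mem_filter.1 hb).2)
    rw [e1, e2]
    have k1 := (abs_le.1 (key {b ∈ t | 0 ≤ D a b})).2
    have k2 := (abs_le.1 (key {b ∈ t | ¬ 0 ≤ D a b})).1
    linarith
  have hsum : ∀ b, ∑ a ∈ s, P.real (U ⁻¹' {a} ∩ V ⁻¹' {b}) = q b := by
    intro b
    have := measureReal_inter_preimage_finset P (V ⁻¹' {b}) U s hUa'
    have hu : U ⁻¹' (s : Set ℝ) = Set.univ := by ext; simp [hs]
    rw [hu, Set.inter_univ] at this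
    simp_rw [Set.inter_comm _ (V ⁻¹' {b})]
    exact this.symm
  have hp1 : ∑ a ∈ s, p a = 1 := by
    have := iU (fun _ => 1)
    simpa using this.symm
  -- Mixing is relative to the `U` side only, so here the trivial bound is used; the factor `ρ`
  -- enters once.
  have hrow : ∀ b, ∑ a ∈ s, |D a b| ≤ 2 * q b := by
    intro b
    calc ∑ a ∈ s, |D a b| ≤ ∑ a ∈ s, (P.real (U ⁻¹' {a} ∩ V ⁻¹' {b}) + p a * q b) := by
          refine Finset.sum_le_sum fun a _ => ?_
          have h1 : 0 ≤ P.real (U ⁻¹' {a} ∩ V ⁻¹' {b}) := measureReal_nonneg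
          have h2 : 0 ≤ p a * q b := mul_nonneg measureReal_nonneg measureReal_nonneg
          rw [abs_le]; constructor <;> simp only [hD] <;> linarith
      _ = 2 * q b := by
          rw [Finset.sum_add_distrib, hsum, ← Finset.sum_mul, hp1]; ring
  have hX : ∑ x ∈ s ×ˢ t, x.1 ^ 2 * |D x.1 x.2| ≤ 2 * ρ * ∫ ω, U ω ^ 2 ∂P := by
    rw [iU (fun x => x ^ 2), Finset.sum_product, Finset.mul_sum]
    refine Finset.sum_le_sum fun a _ => ?_
    dsimp only
    rw [← Finset.mul_sum]
    have := mul_le_mul_of_nonneg_left (hcol a) (sq_nonneg a)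
    linarith
  have hY : ∑ x ∈ s ×ˢ t, x.2 ^ 2 * |D x.1 x.2| ≤ 2 * ∫ ω, V ω ^ 2 ∂P := by
    rw [iV (fun x => x ^ 2), Finset.sum_product_right, Finset.mul_sum]
    refine Finset.sum_le_sum fun b _ => ?_
    dsimp only
    rw [← Finset.mul_sum]
    have := mul_le_mul_of_nonneg_left (hrow b) (sq_nonneg b)
    linarith
  rw [hcov]
  refine (sq_sum_mul_le _ (fun x : ℝ × ℝ => x.1) (fun x => x.2) (fun x => D x.1 x.2)).trans ?_
  refine (mul_le_mul hX hY (Finset.sum_nonneg fun x _ => by positivity)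
    ((Finset.sum_nonneg fun x _ => by positivity).trans hX)).trans (le_of_eq ?_)
  ring

/-- Ibragimov's covariance inequality for bounded functions. -/
theorem sq_cov_le_of_bounded {m₁ m₂ mΩ : MeasurableSpace Ω} (h₁ : m₁ ≤ mΩ) (h₂ : m₂ ≤ mΩ)
    (P : Measure Ω) [IsProbabilityMeasure P] {ρ : ℝ}
    (hρ : ∀ A B, MeasurableSet[m₁] A → MeasurableSet[m₂] B →
      |P.real (A ∩ B) - P.real A * P.real B| ≤ ρ * P.real A)
    (U V : Ω → ℝ) (hU : Measurable[m₁] U) (hV : Measurable[m₂] V) (K : ℝ)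
    (hUK : ∀ ω, |U ω| ≤ K) (hVK : ∀ ω, |V ω| ≤ K) :
    (∫ ω, U ω * V ω ∂P - (∫ ω, U ω ∂P) * ∫ ω, V ω ∂P) ^ 2 ≤
      4 * ρ * (∫ ω, U ω ^ 2 ∂P) * ∫ ω, V ω ^ 2 ∂P := by
  have hU' : StronglyMeasurable[m₁] U := Measurable.stronglyMeasurable hU
  have hV' : StronglyMeasurable[m₂] V := Measurable.stronglyMeasurable hV
  obtain ⟨ω₀⟩ : Nonempty Ω := by
    by_contra h
    rw [not_nonempty_iff] at h
    have := measure_univ (μ := P)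
    rw [Set.univ_eq_empty_iff.2 h] at this
    simp at this
  have hK : 0 ≤ K := (abs_nonneg _).trans (hUK ω₀)
  -- The simple approximants stay measurable for `m₁` and `m₂` respectively, so `hρ` applies to
  -- them, and the common bound `K` gives dominated convergence.
  set u := hU'.approxBounded K
  set v := hV'.approxBounded K
  have ub : ∀ n ω, |u n ω| ≤ K := fun n ω => by
    simpa using hU'.norm_approxBounded_le hK n ω
  have vb : ∀ n ω, |v n ω| ≤ K := fun n ω => by
    simpa using hV'.norm_approxBounded_le hK n ω
  have ut : ∀ ω, Tendsto (fun n => u n ω) atTop (𝓝 (U ω)) := fun ω =>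
    hU'.tendsto_approxBounded_of_norm_le (by simpa using hUK ω)
  have vt : ∀ ω, Tendsto (fun n => v n ω) atTop (𝓝 (V ω)) := fun ω =>
    hV'.tendsto_approxBounded_of_norm_le (by simpa using hVK ω)
  have um : ∀ n, Measurable[m₁] (u n) := fun n => @SimpleFunc.measurable _ _ m₁ _ (u n)
  have vm : ∀ n, Measurable[m₂] (v n) := fun n => @SimpleFunc.measurable _ _ m₂ _ (v n)
  have um' : ∀ n, Measurable (u n) := fun n => (um n).mono h₁ le_rfl
  have vm' : ∀ n, Measurable (v n) := fun n => (vm n).mono h₂ le_rfl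
  have lim : ∀ (F : ℕ → Ω → ℝ) (G : Ω → ℝ) (b : ℝ), (∀ n, Measurable (F n)) →
      (∀ n ω, |F n ω| ≤ b) → (∀ ω, Tendsto (fun n => F n ω) atTop (𝓝 (G ω))) →
      Tendsto (fun n => ∫ ω, F n ω ∂P) atTop (𝓝 (∫ ω, G ω ∂P)) := by
    intro F G b hF hb ht
    exact tendsto_integral_of_dominated_convergence (fun _ => b)
      (fun n => (hF n).aestronglyMeasurable) (integrable_const _)
      (fun n => ae_of_all _ fun ω => by simpa using hb n ω) (ae_of_all _ ht)
  have lU := lim (fun n ω => u n ω) U K um' ub ut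
  have lV := lim (fun n ω => v n ω) V K vm' vb vt
  have lUV := lim (fun n ω => u n ω * v n ω) (fun ω => U ω * V ω) (K * K)
    (fun n => (um' n).mul (vm' n))
    (fun n ω => by rw [abs_mul]; exact mul_le_mul (ub n ω) (vb n ω) (abs_nonneg _) hK)
    (fun ω => (ut ω).mul (vt ω))
  have lU2 := lim (fun n ω => u n ω ^ 2) (fun ω => U ω ^ 2) (K ^ 2) (fun n => (um' n).pow_const 2)
    (fun n ω => by rw [abs_pow]; exact pow_le_pow_left₀ (abs_nonneg _) (ub n ω) 2)
    (fun ω => (ut ω).pow 2)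
  have lV2 := lim (fun n ω => v n ω ^ 2) (fun ω => V ω ^ 2) (K ^ 2) (fun n => (vm' n).pow_const 2)
    (fun n ω => by rw [abs_pow]; exact pow_le_pow_left₀ (abs_nonneg _) (vb n ω) 2)
    (fun ω => (vt ω).pow 2)
  refine le_of_tendsto_of_tendsto' ((lUV.sub (lU.mul lV)).pow 2)
    ((lU2.const_mul (4 * ρ)).mul lV2) fun n => ?_
  exact sq_cov_le_of_finite_range h₁ h₂ P hρ (u n) (v n) (um n) (vm n)
    (@SimpleFunc.range _ _ m₁ (u n)) (@SimpleFunc.range _ _ m₂ (v n))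
    (fun ω => @SimpleFunc.mem_range_self _ _ m₁ (u n) ω)
    (fun ω => @SimpleFunc.mem_range_self _ _ m₂ (v n) ω)

end Covariance

/-! ### From mixing coefficients to covariances. -/

section Mixing

theorem measurable_sigmaOf {Ω : Type*} {X : ℕ → Ω → ℝ} {s : Set ℕ} {i : ℕ} (hi : i ∈ s) : Measurable[sigmaOf X s] (X i) :=
  Measurable.of_comap_le (le_iSup₂_of_le i hi le_rfl)

theorem phiMixing_nonneg {Ω : Type*} [MeasurableSpace Ω] (P : Measure Ω) (X : ℕ → Ω → ℝ) (m : ℕ) : 0 ≤ phiMixing P X m :=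
  Real.sSup_nonneg (by rintro d ⟨k, _, A, B, _, _, _, rfl⟩; exact abs_nonneg _)

variable {Ω : Type*} [MeasurableSpace Ω] {P : Measure Ω} [IsProbabilityMeasure P] {X : ℕ → Ω → ℝ}

theorem sigmaOf_le (hX : ∀ k, 1 ≤ k → Measurable (X k)) {s : Set ℕ} (hs : ∀ i ∈ s, 1 ≤ i) :
    sigmaOf X s ≤ (inferInstance : MeasurableSpace Ω) :=
  iSup₂_le fun i hi => (hX i (hs i hi)).comap_le

/-- Multiplying the conditional form by `P A` removes the requirement `0 < P A`: on null events both
sides vanish. -/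
theorem abs_inter_sub_le_phiMixing (hX : ∀ k, 1 ≤ k → Measurable (X k)) {k m : ℕ} (hk : 1 ≤ k)
    {A B : Set Ω} (hA : MeasurableSet[sigmaOf X (Set.Icc 1 k)] A)
    (hB : MeasurableSet[sigmaOf X (Set.Ici (k + m))] B) :
    |P.real (A ∩ B) - P.real A * P.real B| ≤ phiMixing P X m * P.real A := by
  rcases eq_or_ne (P A) 0 with h0 | h0
  · have h1 : P.real A = 0 := by simp [measureReal_def, h0]
    have h2 : P.real (A ∩ B) = 0 := by
      simp [measureReal_def, measure_mono_null Set.inter_subset_left h0]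
    simp [h1, h2]
  have hA' : MeasurableSet A := sigmaOf_le hX (fun i hi => hi.1) _ hA
  have hpos : 0 < P.real A := by
    rw [measureReal_def]; exact ENNReal.toReal_pos h0 (measure_ne_top _ _)
  -- A real `sSup` dominates the members of its set only when the set is bounded above; here
  -- differences of probabilities are at most 1.
  have hbdd : BddAbove {d : ℝ | ∃ k : ℕ, 1 ≤ k ∧ ∃ A B : Set Ω,
      MeasurableSet[sigmaOf X (Set.Icc 1 k)] A ∧ 0 < P A ∧
      MeasurableSet[sigmaOf X (Set.Ici (k + m))] B ∧ d = |(cond P A).real B - P.real B|} := by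
    refine ⟨1, ?_⟩
    rintro d ⟨k, _, A, B, _, hA0, _, rfl⟩
    have := cond_isProbabilityMeasure hA0.ne'
    rw [abs_le]
    constructor <;>
    linarith [measureReal_nonneg (μ := P) (s := B), measureReal_nonneg (μ := cond P A) (s := B),
      measureReal_le_one (μ := P) (s := B), measureReal_le_one (μ := cond P A) (s := B)]
  have hle : |(cond P A).real B - P.real B| ≤ phiMixing P X m :=
    le_csSup hbdd ⟨k, hk, A, B, hA, pos_iff_ne_zero.2 h0, hB, rfl⟩
  rw [measureReal_def (cond P A), cond_apply hA', ENNReal.toReal_mul, ENNReal.toReal_inv,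
    ← measureReal_def, ← measureReal_def] at hle
  have : P.real (A ∩ B) - P.real A * P.real B =
      ((P.real A)⁻¹ * P.real (A ∩ B) - P.real B) * P.real A := by
    field_simp
  rw [this, abs_mul, abs_of_pos hpos]
  exact mul_le_mul_of_nonneg_right hle hpos.le

theorem abs_cov_comp_le (hX : ∀ k, 1 ≤ k → Measurable (X k)) {T : ℝ → ℝ} (hT : Measurable T)
    {K : ℝ} (hTK : ∀ x, |T x| ≤ K) {σ : ℝ} (hσ : ∀ k, 1 ≤ k → ∫ ω, T (X k ω) ^ 2 ∂P ≤ σ)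
    {i j : ℕ} (hi : 1 ≤ i) (hij : i ≤ j) :
    |∫ ω, T (X i ω) * T (X j ω) ∂P - (∫ ω, T (X i ω) ∂P) * ∫ ω, T (X j ω) ∂P| ≤
      2 * √(phiMixing P X (j - i)) * σ := by
  have h := sq_cov_le_of_bounded (sigmaOf_le hX (s := Set.Icc 1 i) fun i hi => hi.1)
    (sigmaOf_le hX (s := Set.Ici (i + (j - i))) fun a ha => hi.trans
      ((Nat.le_add_right _ _).trans ha)) P
    (fun A B hA hB => abs_inter_sub_le_phiMixing hX hi hA hB)
    (fun ω => T (X i ω)) (fun ω => T (X j ω))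
    (hT.comp (measurable_sigmaOf ⟨hi, le_rfl⟩))
    (hT.comp (measurable_sigmaOf (by simp [hij]))) K (fun ω => hTK _) (fun ω => hTK _)
  have hσ0 : 0 ≤ σ := (integral_nonneg fun ω => sq_nonneg (T (X 1 ω))).trans (hσ 1 le_rfl)
  have hφ := phiMixing_nonneg P X (j - i)
  refine abs_le_of_sq_le_sq (h.trans ?_) (by positivity)
  rw [mul_pow, mul_pow, Real.sq_sqrt hφ]
  have h1 := hσ i hi
  have h2 := hσ j (hi.trans hij)
  have h3 : 0 ≤ ∫ ω, T (X i ω) ^ 2 ∂P := integral_nonneg fun ω => sq_nonneg _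
  have h4 : 0 ≤ ∫ ω, T (X j ω) ^ 2 ∂P := integral_nonneg fun ω => sq_nonneg _
  have := mul_le_mul h1 h2 h4 hσ0
  calc _ = 4 * phiMixing P X (j - i) * ((∫ ω, T (X i ω) ^ 2 ∂P) * ∫ ω, T (X j ω) ^ 2 ∂P) := by ring
    _ ≤ 4 * phiMixing P X (j - i) * (σ * σ) := by gcongr
    _ = _ := by ring

end Mixing

/-! ### Variance of sums of bounded functions of the sequence. -/

section Variance

theorem sum_comp_le_tsum {ι : Type*} {f : ℕ → ℝ} (hf : Summable f) (h0 : ∀ n, 0 ≤ f n)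
    (s : Finset ι) (g : ι → ℕ) (hg : Set.InjOn g s) : ∑ x ∈ s, f (g x) ≤ ∑' n, f n := by
  classical
  rw [← Finset.sum_image hg]
  exact hf.sum_le_tsum _ fun n _ => h0 n

variable {Ω : Type*} [MeasurableSpace Ω] {P : Measure Ω} [IsProbabilityMeasure P] {X : ℕ → Ω → ℝ}

/-- In each row of the covariance matrix the diagonal contributes at most `σ`, and every lag occurs
at most once on either side of it, so each side contributes at most `2φσ`. -/
theorem variance_sum_comp_le (hX : ∀ k, 1 ≤ k → Measurable (X k))
    (hsum : Summable fun m : ℕ => √(phiMixing P X (m + 1))) {T : ℝ → ℝ} (hT : Measurable T)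
    {K : ℝ} (hTK : ∀ x, |T x| ≤ K) {σ : ℝ} (hσ : ∀ k, 1 ≤ k → ∫ ω, T (X k ω) ^ 2 ∂P ≤ σ) (n : ℕ) :
    Var[fun ω => ∑ k ∈ Finset.Icc 1 n, T (X k ω); P] ≤ n * (1 + 4 * phiMixingSum P X) * σ := by
  have hσ0 : 0 ≤ σ := (integral_nonneg fun ω => sq_nonneg (T (X 1 ω))).trans (hσ 1 le_rfl)
  have hL : ∀ k, 1 ≤ k → MemLp (fun ω => T (X k ω)) 2 P := fun k hk =>
    MemLp.of_bound (hT.comp (hX k hk)).aestronglyMeasurable K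
      (ae_of_all _ fun ω => by simpa using hTK (X k ω))
  -- The lag is written `(j - i - 1) + 1` to match the shifted index in `phiMixingSum`.
  have hcov : ∀ i j, 1 ≤ i → 1 ≤ j → i < j →
      cov[fun ω => T (X i ω), fun ω => T (X j ω); P] ≤
        2 * √(phiMixing P X ((j - i - 1) + 1)) * σ := by
    intro i j hi hj hij
    rw [covariance_eq_sub (hL i hi) (hL j hj), Nat.sub_add_cancel (by omega)]
    exact (le_abs_self _).trans (abs_cov_comp_le hX hT hTK hσ hi hij.le)
  have hdiag : ∀ i, 1 ≤ i → cov[fun ω => T (X i ω), fun ω => T (X i ω); P] ≤ σ := by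
    intro i hi
    have hm : Measurable fun ω => T (X i ω) := hT.comp (hX i hi)
    rw [covariance_self hm.aemeasurable]
    refine (variance_le_expectation_sq hm.aestronglyMeasurable).trans ?_
    exact hσ i hi
  rw [variance_fun_sum' fun i hi => hL i (Finset.mem_Icc.1 hi).1]
  have hrow : ∀ i ∈ Finset.Icc 1 n, ∑ j ∈ Finset.Icc 1 n,
      cov[fun ω => T (X i ω), fun ω => T (X j ω); P] ≤ (1 + 4 * phiMixingSum P X) * σ := by
    intro i hi
    have hi1 := (Finset.mem_Icc.1 hi).1
    rw [← Finset.add_sum_erase _ _ hi, ← Finset.sum_filter_add_sum_filter_not _ (fun j => i < j)]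
    have h0 := hdiag i hi1
    have h1 : ∑ j ∈ (Finset.Icc 1 n).erase i with i < j,
        cov[fun ω => T (X i ω), fun ω => T (X j ω); P] ≤ 2 * phiMixingSum P X * σ := by
      calc _ ≤ ∑ j ∈ (Finset.Icc 1 n).erase i with i < j,
            2 * √(phiMixing P X ((j - i - 1) + 1)) * σ := by
              refine Finset.sum_le_sum fun j hj => ?_
              simp only [Finset.mem_filter, Finset.mem_erase, Finset.mem_Icc] at hj
              exact hcov i j hi1 hj.1.2.1 hj.2
        _ ≤ _ := by
              rw [← Finset.sum_mul, ← Finset.mul_sum]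
              gcongr
              refine sum_comp_le_tsum hsum (fun m => Real.sqrt_nonneg _) _ (fun j => j - i - 1) ?_
              intro a ha b hb hab
              simp only [Finset.coe_filter, Set.mem_ofPred_eq] at ha hb hab
              omega
    have h2 : ∑ j ∈ (Finset.Icc 1 n).erase i with ¬ i < j,
        cov[fun ω => T (X i ω), fun ω => T (X j ω); P] ≤ 2 * phiMixingSum P X * σ := by
      calc _ ≤ ∑ j ∈ (Finset.Icc 1 n).erase i with ¬ i < j,
            2 * √(phiMixing P X ((i - j - 1) + 1)) * σ := by
              refine Finset.sum_le_sum fun j hj => ?_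
              simp only [Finset.mem_filter, Finset.mem_erase, Finset.mem_Icc] at hj
              rw [covariance_comm]
              exact hcov j i hj.1.2.1 hi1 (by omega)
        _ ≤ _ := by
              rw [← Finset.sum_mul, ← Finset.mul_sum]
              gcongr
              refine sum_comp_le_tsum hsum (fun m => Real.sqrt_nonneg _) _ (fun j => i - j - 1) ?_
              intro a ha b hb hab
              simp only [Finset.coe_filter, Set.mem_ofPred_eq, Finset.mem_erase] at ha hb hab
              omega
    linarith
  refine (Finset.sum_le_sum hrow).trans (le_of_eq ?_)
  simp; ring

end Variance

/-! ### Truncation and the weak-type inequality. -/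

section WeakType

theorem measurable_truncate (t : ℝ) : Measurable ((Set.Icc (-t) t).indicator (id : ℝ → ℝ)) :=
  measurable_id.indicator measurableSet_Icc

theorem truncate_sq_le {α t : ℝ} (hα1 : α < 1) (ht : 0 < t) (x : ℝ) :
    (Set.Icc (-t) t).indicator (id : ℝ → ℝ) x ^ 2 ≤ t ^ (1 - α) * |x| ^ (1 + α) := by
  by_cases hx : x ∈ Set.Icc (-t) t
  · rw [Set.indicator_of_mem hx, id]
    rcases eq_or_ne x 0 with rfl | h0
    · simp only [ne_eq, OfNat.ofNat_ne_zero, not_false_eq_true, zero_pow]; positivity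
    have hp : 0 < |x| := abs_pos.2 h0
    calc x ^ 2 = |x| ^ (1 - α) * |x| ^ (1 + α) := by
          rw [← Real.rpow_add hp, ← sq_abs, ← Real.rpow_natCast]; congr 1; push_cast; ring
      _ ≤ _ := by
          gcongr ?_ * _
          exact Real.rpow_le_rpow (abs_nonneg x) (abs_le.2 hx) (by linarith)
  · rw [Set.indicator_of_notMem hx]
    simp only [ne_eq, OfNat.ofNat_ne_zero, not_false_eq_true, zero_pow]; positivity

/-- The remainder lives on `|x| > t`, where `(|x| / t) ^ α` exceeds 1. This controls the bias, as
`truncate_sq_le` controls the variance. -/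
theorem abs_sub_truncate_le {α t : ℝ} (hα0 : 0 < α) (ht : 0 < t) (x : ℝ) :
    |x - (Set.Icc (-t) t).indicator (id : ℝ → ℝ) x| ≤ t ^ (-α) * |x| ^ (1 + α) := by
  by_cases hx : x ∈ Set.Icc (-t) t
  · rw [Set.indicator_of_mem hx, id, sub_self, abs_zero]; positivity
  · rw [Set.indicator_of_notMem hx, sub_zero]
    have hxt : t < |x| := by
      by_contra h; exact hx (abs_le.1 (not_lt.1 h))
    have hp : 0 < |x| := ht.trans hxt
    calc |x| = |x| ^ (-α) * |x| ^ (1 + α) := by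
          rw [← Real.rpow_add hp]; simp
      _ ≤ _ := by
          gcongr ?_ * _
          exact Real.rpow_le_rpow_of_nonpos ht hxt.le (by linarith)

theorem integrable_abs_rpow_of_momentSup_le {Ω : Type*} [MeasurableSpace Ω] {P : Measure Ω}
    {X : ℕ → Ω → ℝ} {α ν : ℝ} (hX : ∀ k, 1 ≤ k → Measurable (X k))
    (h : momentSup P X α ≤ ENNReal.ofReal ν) (hν : 0 ≤ ν) {k : ℕ} (hk : 1 ≤ k) :
    Integrable (fun ω => |X k ω| ^ (1 + α)) P ∧ ∫ ω, |X k ω| ^ (1 + α) ∂P ≤ ν := by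
  have hm : Measurable fun ω => |X k ω| ^ (1 + α) := by
    have := hX k hk; fun_prop
  have h0 : 0 ≤ᵐ[P] fun ω => |X k ω| ^ (1 + α) := ae_of_all _ fun ω => by positivity
  have hle : ∫⁻ ω, ENNReal.ofReal (|X k ω| ^ (1 + α)) ∂P ≤ ENNReal.ofReal ν :=
    (le_iSup₂_of_le (f := fun n (_ : n ∈ Set.Ici (1 : ℕ)) =>
      ∫⁻ ω, ENNReal.ofReal (|X n ω| ^ (1 + α)) ∂P) k hk le_rfl).trans h
  refine ⟨⟨hm.aestronglyMeasurable, ?_⟩, ?_⟩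
  · rw [hasFiniteIntegral_iff_ofReal h0]
    exact hle.trans_lt ENNReal.ofReal_lt_top
  · rw [integral_eq_lintegral_of_nonneg_ae h0 hm.aestronglyMeasurable]
    exact ENNReal.toReal_le_of_le_ofReal hν hle

variable {Ω : Type*} [MeasurableSpace Ω] {P : Measure Ω} [IsProbabilityMeasure P] {X : ℕ → Ω → ℝ}

/-- Weak-type moment inequality of order `1 + α` for sums of `φ`-mixing variables, by truncation
at the level `t`. -/
theorem measureReal_sum_sub_ge_le (hX : ∀ k, 1 ≤ k → Measurable (X k))
    (hsum : Summable fun m : ℕ => √(phiMixing P X (m + 1))) {α ν μ : ℝ} (hα0 : 0 < α)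
    (hα1 : α < 1) (hν : 0 ≤ ν) (hmom : momentSup P X α ≤ ENNReal.ofReal ν)
    (hmean : ∀ k, 1 ≤ k → ∫ ω, X k ω ∂P = μ) (n : ℕ) {t q : ℝ} (ht : 0 < t) (hq : 1 < q)
    (hqt : q * (n * ν) ≤ t ^ (1 + α)) :
    P.real {ω | t ≤ |∑ k ∈ Finset.Icc 1 n, X k ω - n * μ|} ≤
      (1 + (1 + 4 * phiMixingSum P X) / (1 - 1 / q) ^ 2) / q := by
  set T : ℝ → ℝ := (Set.Icc (-t) t).indicator (id : ℝ → ℝ) with hTdef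
  have hT : Measurable T := measurable_truncate t
  have hTK : ∀ x, |T x| ≤ t := by
    intro x
    by_cases hx : x ∈ Set.Icc (-t) t
    · simpa [hTdef, Set.indicator_of_mem hx] using abs_le.2 hx
    · simp [hTdef, Set.indicator_of_notMem hx, ht.le]
  have hq0 : 0 < q := one_pos.trans hq
  have hpow : 0 < t ^ (1 + α) := by positivity
  -- This form of `hqt` serves both the bias and, after multiplication by `t`, the variance.
  have hnu : n * ν * t ^ (-α) ≤ t / q := by
    rw [le_div_iff₀ hq0]
    calc n * ν * t ^ (-α) * q = q * (n * ν) * t ^ (-α) := by ring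
      _ ≤ t ^ (1 + α) * t ^ (-α) := by gcongr
      _ = t := by rw [← Real.rpow_add ht]; simp
  have hφ : 0 ≤ phiMixingSum P X := tsum_nonneg fun _ => Real.sqrt_nonneg _
  have hI := fun k (hk : 1 ≤ k) => integrable_abs_rpow_of_momentSup_le hX hmom hν hk
  have hTint : ∀ k, 1 ≤ k → Integrable (fun ω => T (X k ω)) P := fun k hk =>
    Integrable.of_bound (hT.comp (hX k hk)).aestronglyMeasurable t
      (ae_of_all _ fun ω => by simpa using hTK (X k ω))
  have hRint : ∀ k, 1 ≤ k → Integrable (fun ω => X k ω - T (X k ω)) P := fun k hk =>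
    ((hI k hk).1.const_mul (t ^ (-α))).mono'
      ((hX k hk).sub (hT.comp (hX k hk))).aestronglyMeasurable
      (ae_of_all _ fun ω => abs_sub_truncate_le hα0 ht (X k ω))
  have hσ : ∀ k, 1 ≤ k → ∫ ω, T (X k ω) ^ 2 ∂P ≤ t ^ (1 - α) * ν := by
    intro k hk
    calc ∫ ω, T (X k ω) ^ 2 ∂P ≤ ∫ ω, t ^ (1 - α) * |X k ω| ^ (1 + α) ∂P :=
          integral_mono_of_nonneg (ae_of_all _ fun ω => sq_nonneg _) ((hI k hk).1.const_mul _)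
            (ae_of_all _ fun ω => truncate_sq_le hα1 ht (X k ω))
      _ ≤ _ := by
          rw [integral_const_mul]
          exact mul_le_mul_of_nonneg_left (hI k hk).2 (by positivity)
  set S : Ω → ℝ := fun ω => ∑ k ∈ Finset.Icc 1 n, T (X k ω) with hS
  have hbias : |∫ ω, S ω ∂P - n * μ| ≤ t / q := by
    have h1 : ∀ k, 1 ≤ k → |∫ ω, T (X k ω) ∂P - μ| ≤ t ^ (-α) * ν := by
      intro k hk
      have e : ∫ ω, (X k ω - T (X k ω)) ∂P = μ - ∫ ω, T (X k ω) ∂P := by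
        have hXint : Integrable (X k) P := by
          have := (hRint k hk).add (hTint k hk)
          refine this.congr (ae_of_all _ fun ω => by simp)
        rw [integral_sub hXint (hTint k hk), hmean k hk]
      rw [abs_sub_comm, ← e]
      refine (abs_integral_le_integral_abs).trans ?_
      refine (integral_mono (hRint k hk).abs ((hI k hk).1.const_mul (t ^ (-α)))
        fun ω => abs_sub_truncate_le hα0 ht (X k ω)).trans ?_
      rw [integral_const_mul]
      exact mul_le_mul_of_nonneg_left (hI k hk).2 (by positivity)
    have h2 : ∫ ω, S ω ∂P - n * μ = ∑ k ∈ Finset.Icc 1 n, (∫ ω, T (X k ω) ∂P - μ) := by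
      rw [hS, integral_finsetSum _ fun k hk => hTint k (Finset.mem_Icc.1 hk).1]
      simp [Finset.sum_sub_distrib]
    rw [h2]
    refine (Finset.abs_sum_le_sum_abs _ _).trans ?_
    refine (Finset.sum_le_sum fun k hk => h1 k (Finset.mem_Icc.1 hk).1).trans ?_
    simp only [Finset.sum_const, Nat.card_Icc, add_tsub_cancel_right, nsmul_eq_mul]
    linarith
  have hSL : MemLp S 2 P := memLp_finsetSum _ fun k hk =>
    MemLp.of_bound (hT.comp (hX k (Finset.mem_Icc.1 hk).1)).aestronglyMeasurable t
      (ae_of_all _ fun ω => by simpa using hTK (X k ω))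
  -- What remains of the deviation `t` once the bias `t / q` is subtracted.
  set u : ℝ := t * (1 - 1 / q) with hu
  have hq1 : 0 < 1 - 1 / q := by
    rw [sub_pos, div_lt_one hq0]; exact hq
  have hu0 : 0 < u := mul_pos ht hq1
  have hsub : {ω | t ≤ |∑ k ∈ Finset.Icc 1 n, X k ω - n * μ|} ⊆
      (⋃ k ∈ Finset.Icc 1 n, {ω | t ^ (1 + α) ≤ |X k ω| ^ (1 + α)}) ∪
        {ω | u ≤ |S ω - ∫ ω, S ω ∂P|} := by
    intro ω hω
    by_cases hb : ∃ k ∈ Finset.Icc 1 n, t < |X k ω|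
    · obtain ⟨k, hk, hkt⟩ := hb
      left
      simp only [Set.mem_iUnion, Set.mem_ofPred_eq]
      exact ⟨k, hk, Real.rpow_le_rpow ht.le hkt.le (by linarith)⟩
    · right
      push Not at hb
      have e : ∑ k ∈ Finset.Icc 1 n, X k ω = S ω := by
        refine Finset.sum_congr rfl fun k hk => ?_
        rw [hTdef, Set.indicator_of_mem (Set.mem_Icc.2 (abs_le.1 (hb k hk))), id]
      simp only [Set.mem_ofPred_eq, e] at hω ⊢
      have := abs_add_le (S ω - ∫ ω, S ω ∂P) (∫ ω, S ω ∂P - n * μ)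
      rw [sub_add_sub_cancel] at this
      have hu' : u = t - t / q := by rw [hu]; ring
      linarith
  have hlarge : P.real (⋃ k ∈ Finset.Icc 1 n, {ω | t ^ (1 + α) ≤ |X k ω| ^ (1 + α)}) ≤ 1 / q := by
    refine (measureReal_biUnion_finset_le _ _).trans ?_
    have h1 : ∀ k ∈ Finset.Icc 1 n, P.real {ω | t ^ (1 + α) ≤ |X k ω| ^ (1 + α)} ≤
        ν / t ^ (1 + α) := by
      intro k hk
      have hk1 := (Finset.mem_Icc.1 hk).1
      rw [le_div_iff₀' hpow]
      exact (mul_meas_ge_le_integral_of_nonneg (ae_of_all _ fun ω => by positivity)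
        (hI k hk1).1 _).trans (hI k hk1).2
    refine (Finset.sum_le_sum h1).trans ?_
    simp only [Finset.sum_const, Nat.card_Icc, add_tsub_cancel_right, nsmul_eq_mul]
    rw [← mul_div_assoc, div_le_div_iff₀ hpow hq0]
    linarith
  have hcheb : P.real {ω | u ≤ |S ω - ∫ ω, S ω ∂P|} ≤
      (1 + 4 * phiMixingSum P X) / (1 - 1 / q) ^ 2 / q := by
    have h1 : P.real {ω | u ≤ |S ω - ∫ ω, S ω ∂P|} ≤ Var[S; P] / u ^ 2 :=
      ENNReal.toReal_le_of_le_ofReal (div_nonneg (variance_nonneg _ _) (sq_nonneg _))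
        (meas_ge_le_variance_div_sq hSL hu0)
    refine h1.trans ?_
    have h2 := variance_sum_comp_le hX hsum hT hTK hσ n
    have h3 : n * (t ^ (1 - α) * ν) ≤ t ^ 2 / q := by
      have e : t ^ (1 - α) = t * t ^ (-α) := by
        rw [sub_eq_add_neg, Real.rpow_add ht, Real.rpow_one]
      rw [e]
      calc n * (t * t ^ (-α) * ν) = t * (n * ν * t ^ (-α)) := by ring
        _ ≤ t * (t / q) := by gcongr
        _ = t ^ 2 / q := by ring
    calc Var[S; P] / u ^ 2 ≤ (n * (1 + 4 * phiMixingSum P X) * (t ^ (1 - α) * ν)) / u ^ 2 := by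
          gcongr
      _ = (1 + 4 * phiMixingSum P X) * (n * (t ^ (1 - α) * ν)) / u ^ 2 := by ring
      _ ≤ (1 + 4 * phiMixingSum P X) * (t ^ 2 / q) / u ^ 2 := by gcongr
      _ = _ := by rw [hu]; field_simp
  calc _ ≤ _ := measureReal_mono hsub
    _ ≤ _ := measureReal_union_le _ _
    _ ≤ 1 / q + (1 + 4 * phiMixingSum P X) / (1 - 1 / q) ^ 2 / q := add_le_add hlarge hcheb
    _ = _ := by ring

end WeakType

/-! ### The constants and the choice of truncation level. -/

section Constants

/-- Both squared denominators lie in `(0, 1]`, so the bound holds uniformly in `ε`; whether the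
infimum is attained plays no role. -/
theorem le_momentConst {α φ : ℝ} (hα0 : 0 < α) (hα1 : α < 1) (hφ : 0 ≤ φ) :
    2 + 4 * (1 + 4 * φ) ≤ momentConst α φ := by
  refine le_csInf (Set.image_nonempty.2 ⟨1, by simp⟩) ?_
  rintro _ ⟨ε, hε, rfl⟩
  have hε : 0 < ε := hε
  have h1 : (1 + ε)⁻¹ < 1 := inv_lt_one_of_one_lt₀ (by linarith)
  have h2 : 0 < (1 + ε)⁻¹ := by positivity
  have h3 : 1 + 4 * φ ≤ (1 + 4 * φ) / (1 - (1 + ε)⁻¹) ^ 2 :=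
    le_div_self (by linarith) (by nlinarith) (by nlinarith)
  have h4 : (4 : ℝ) ≤ 4 / (1 - α) ^ 2 := le_div_self (by norm_num) (by nlinarith) (by nlinarith)
  have h5 := mul_le_mul h3 h4 (by norm_num) ((by linarith : (0 : ℝ) ≤ 1 + 4 * φ).trans h3)
  unfold momentFactor
  linarith

theorem coeffTail_rpow {α ν φ : ℝ} (hα0 : 0 < α) (h : 0 ≤ momentConst α φ * ν) :
    coeffTail α ν φ ^ (1 + α) = 2 ^ (1 + α) * (momentConst α φ * ν) := by
  unfold coeffTail
  rw [Real.mul_rpow (by norm_num) (by positivity), ← Real.rpow_mul h,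
    one_div_mul_cancel (by linarith), Real.rpow_one]

/-- The exponent `r / 2` exceeds 1. Summability must be known, since a divergent `tsum` has the
default value 0 and would bound nothing. -/
theorem summable_sqrt_phiMixing {Ω : Type*} [MeasurableSpace Ω] {P : Measure Ω}
    {X : ℕ → Ω → ℝ} {C r : ℝ} (hr : 2 < r) (hC : 0 < C)
    (hmix : ∀ m : ℕ, 1 ≤ m → phiMixing P X m ≤ C * ((m : ℝ) + 1) ^ (-r)) :
    Summable fun m : ℕ => √(phiMixing P X (m + 1)) := by
  have h1 : Summable fun m : ℕ => √C * ((m + 2 : ℕ) : ℝ) ^ (-r / 2) :=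
    ((summable_nat_add_iff 2).2 (Real.summable_nat_rpow.2 (by linarith))).mul_left _
  refine h1.of_nonneg_of_le (fun m => Real.sqrt_nonneg _) fun m => ?_
  refine (Real.sqrt_le_sqrt (hmix (m + 1) (by omega))).trans (le_of_eq ?_)
  rw [Real.sqrt_mul hC.le, Real.sqrt_eq_rpow (_ ^ _), ← Real.rpow_mul (by positivity)]
  push_cast
  congr 2
  · ring
  · ring

/-- At `t = n a₂ (p / n) ^ γ` the ratio `t ^ (1 + α) / (n ν)` is at least `2 ^ (2 + α) c_α / δ`. -/
theorem mul_le_tail_rpow {α α' r δ ν φ p n n₁ : ℝ} (hα0 : 0 < α) (hα' : α' < α) (hr : 2 < r)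
    (hν : 0 < ν) (hp : 0 < p) (hn₁ : 0 < n₁) (hn : n₁ ≤ n)
    (hM : 0 < momentConst α φ) (h : p ^ (-α) * (p / n₁) ^ ((α - α') / (1 + r)) = δ / 2) :
    2 ^ (2 + α) * momentConst α φ / δ * (n * ν) ≤
      (n * (coeffTail α ν φ * (p / n) ^ rateTail α α' r)) ^ (1 + α) := by
  have hn0 : 0 < n := hn₁.trans_le hn
  set x := p / n with hx
  have hx0 : 0 < x := by positivity
  set e := (α - α') / (1 + r) with he
  have he0 : 0 ≤ e := div_nonneg (by linarith) (by linarith)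
  have hle : p ^ (-α) * x ^ e ≤ δ / 2 := by
    rw [← h]; gcongr ?_ * ?_ ^ _
    exact div_le_div_of_nonneg_left hp.le hn₁ hn
  -- The exponent of `x` equals `α - e` and `n * x = p`, so the right side is the inverse of `p ^
  -- (-α) * x ^ e`, which `hle` bounds by `δ / 2`.
  have hkey : 2 / δ ≤ n ^ α * x ^ (rateTail α α' r * (1 + α)) := by
    have hg : rateTail α α' r * (1 + α) = α + -e := by
      have h1 : (1 + α) ≠ 0 := by linarith
      have h2 : (1 + r) ≠ 0 := by linarith
      rw [rateTail, he]; field_simp; ring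
    rw [hg, Real.rpow_add hx0, ← mul_assoc, ← Real.mul_rpow hn0.le hx0.le]
    have hnx : n * x = p := by rw [hx]; field_simp
    have hinv : p ^ α * x ^ (-e) = (p ^ (-α) * x ^ e)⁻¹ := by
      rw [Real.rpow_neg hx0.le, Real.rpow_neg hp.le, mul_inv, inv_inv]
    rw [hnx, hinv, ← inv_div]
    exact inv_anti₀ (by positivity) hle
  have hA : 0 ≤ coeffTail α ν φ := by unfold coeffTail; positivity
  rw [Real.mul_rpow hn0.le (by positivity), Real.mul_rpow hA (by positivity),
    coeffTail_rpow hα0 (by positivity), ← Real.rpow_mul hx0.le, Real.rpow_add hn0, Real.rpow_one,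
    show (2 : ℝ) + α = 1 + (1 + α) by ring, Real.rpow_add two_pos 1, Real.rpow_one]
  calc 2 * 2 ^ (1 + α) * momentConst α φ / δ * (n * ν)
      = n * (2 ^ (1 + α) * (momentConst α φ * ν)) * (2 / δ) := by ring
    _ ≤ n * (2 ^ (1 + α) * (momentConst α φ * ν)) *
        (n ^ α * x ^ (rateTail α α' r * (1 + α))) := by gcongr
    _ = _ := by ring

end Constants

/-- The tail term alone already bounds the deviation, so that `n₀ = 1` is admissible. -/
theorem corollary1
    (α r C ν φ c c₀ δ : ℝ)
    (hα0 : 0 < α) (hα1 : α < 1) (hr : 2 < r) (hC : 0 < C) (hν : 0 < ν)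
    (hδ0 : 0 < δ) (hδ1 : δ < 1)
    (hc₀ : 2 * prefactor C r * δ ^ c₀ = δ / 2) (hc : c₀ ≤ c) :
    ∃ n₀ : ℝ, 0 < n₀ ∧
      ∀ (Ω : Type*) [MeasurableSpace Ω] (P : Measure Ω) [IsProbabilityMeasure P]
        (X : ℕ → Ω → ℝ) (μ : ℝ),
        (∀ k : ℕ, 1 ≤ k → Measurable (X k)) →
        (∀ m : ℕ, 1 ≤ m → phiMixing P X m ≤ C * ((m : ℝ) + 1) ^ (-r)) →
        phiMixingSum P X = φ →
        momentSup P X α = ENNReal.ofReal ν →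
        (∀ k : ℕ, 1 ≤ k → ∫ ω, X k ω ∂P = μ) →
        ∀ α' : ℝ, 0 ≤ α' → α' < α →
        ∀ n₁ : ℝ, 0 < n₁ →
          (2 * Real.log (1 / δ)) ^ (-α) *
            (2 * Real.log (1 / δ) / n₁) ^ ((α - α') / (1 + r)) = δ / 2 →
        ∀ n : ℕ, max n₀ n₁ ≤ (n : ℝ) →
          1 - δ ≤ P.real {ω | |(n : ℝ)⁻¹ * ∑ k ∈ Finset.Icc 1 n, X k ω - μ| <
            coeffMain c ν φ * (2 * Real.log (1 / δ) / n) ^ rateMain α r +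
            coeffTail α ν φ * (2 * Real.log (1 / δ) / n) ^ rateTail α α' r} := by
  refine ⟨1, one_pos, ?_⟩
  intro Ω _ P _ X μ hX hmix hφ hmom hmean α' _ hα' n₁ hn₁ heq n hn
  have hsum := summable_sqrt_phiMixing hr hC hmix
  have hφ0 : 0 ≤ φ := hφ ▸ tsum_nonneg fun _ => Real.sqrt_nonneg _
  have hp : 0 < 2 * Real.log (1 / δ) :=
    mul_pos two_pos (Real.log_pos (by rw [lt_div_iff₀ hδ0]; linarith))
  set p := 2 * Real.log (1 / δ) with hp_def
  have hn0 : (0 : ℝ) < n := one_pos.trans_le ((le_max_left _ _).trans hn)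
  have hM := le_momentConst hα0 hα1 hφ0
  have hM0 : 0 < momentConst α φ := by linarith
  have hA : 0 < coeffTail α ν φ := by unfold coeffTail; positivity
  set a := coeffTail α ν φ * (p / n) ^ rateTail α α' r with ha
  have ha0 : 0 < a := by positivity
  have hb0 : 0 ≤ coeffMain c ν φ * (p / n) ^ rateMain α r := by unfold coeffMain; positivity
  set q := 2 ^ (2 + α) * momentConst α φ / δ with hq
  -- Four times the lower bound for `c_α`, as `2 ^ (2 + α) ≥ 4`.
  have hqδ : 8 + 16 * (1 + 4 * φ) ≤ q * δ := by
    have h2 : (4 : ℝ) ≤ 2 ^ (2 + α) := by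
      rw [Real.rpow_add two_pos]
      have := Real.one_le_rpow (one_le_two : (1 : ℝ) ≤ 2) hα0.le
      norm_num; linarith
    rw [hq, div_mul_cancel₀ _ hδ0.ne']
    nlinarith
  have hq0 : 0 < q := by positivity
  have hq2 : 2 < q := by nlinarith
  have hweak := measureReal_sum_sub_ge_le hX hsum hα0 hα1 hν.le hmom.le hmean n
    (mul_pos hn0 ha0) (by linarith : 1 < q)
    (mul_le_tail_rpow hα0 hα' hr hν hp hn₁ ((le_max_right _ _).trans hn) hM0 heq)
  rw [hφ] at hweak
  -- Since `q > 2`, the squared factor is at least `1 / 4`, and `1 + 4 * (1 + 4 * φ) ≤ q * δ` is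
  -- enough.
  have hδle : (1 + (1 + 4 * φ) / (1 - 1 / q) ^ 2) / q ≤ δ := by
    have h1 : 1 / q ≤ 1 / 2 := one_div_le_one_div_of_le two_pos hq2.le
    have h2 : (1 / 4 : ℝ) ≤ (1 - 1 / q) ^ 2 := by nlinarith
    have h3 : (1 + 4 * φ) / (1 - 1 / q) ^ 2 ≤ (1 + 4 * φ) / (1 / 4) := by gcongr
    rw [div_le_iff₀ hq0]
    linarith
  set E := {ω | |(n : ℝ)⁻¹ * ∑ k ∈ Finset.Icc 1 n, X k ω - μ| <
    coeffMain c ν φ * (p / n) ^ rateMain α r + a} with hE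
  have hcompl : Eᶜ ⊆ {ω | n * a ≤ |∑ k ∈ Finset.Icc 1 n, X k ω - n * μ|} := by
    intro ω hω
    simp only [hE, Set.mem_compl_iff, Set.mem_ofPred_eq, not_lt] at hω ⊢
    have e : ∑ k ∈ Finset.Icc 1 n, X k ω - n * μ =
        n * ((n : ℝ)⁻¹ * ∑ k ∈ Finset.Icc 1 n, X k ω - μ) := by field_simp
    rw [e, abs_mul, abs_of_pos hn0]
    gcongr
    linarith
  -- Subadditivity alone gives this, with no need for measurability of `E`.
  have h1 : (1 : ℝ) ≤ P.real E + P.real Eᶜ := by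
    have := measureReal_union_le (μ := P) E Eᶜ
    rwa [Set.union_compl_self, probReal_univ] at this
  have h2 := (measureReal_mono (μ := P) hcompl).trans (hweak.trans hδle)
  linarith
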